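/- Let $k$ be a field and let $\hat B = k[\![x,y,z]\!]/(xy,yz,xz)$, a complete local ring. For a finitely generated $\hat B$-module $M$ with minimal free resolution $\cdots \to F_2 \to F_1 \to F_0 \to M \to 0$, the Betti sequence of $M$ is $\beta(M) = (\operatorname{rank} F_0, \operatorname{rank} F_1, \operatorname{rank} F_2, \dots)$, regarded as an element of the $\mathbf{Q}$-vector space $\mathbf{Q}^{\mathbf{N}}$ of all rational sequences $(\beta_0,\beta_1,\beta_2,\dots)$. Cones are taken in $\mathbf{Q}^{\mathbf{N}}$, and the cone spanned by a set is the set of its finite linear combinations with coefficients in $\mathbf{Q}_{\ge 0}$. Then the following three cones are equal: (i) the cone spanned by the Betti sequences of all finitely generated $\hat B$-modules; (ii) the cone spanned by $(1,0,0,\dots)$, $(1,1,0,0,\dots)$ and $(1,3,6,12,24,\dots)$, where the last sequence has $\beta_0 = 1$ and $\beta_i = 3\cdot 2^{i-1}$ for $i \ge 1$, and the other entries of the first two are $0$; (iii) the cone of all sequences $(\beta_i)_{i \ge 0} \in \mathbf{Q}^{\mathbf{N}}$ with $\beta_2 \ge 0$, $3\beta_0 + \beta_2 \ge 3\beta_1$,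 $2\beta_1 \ge \beta_2$, and $\beta_i = 2\beta_{i-1}$ for all $i > 2$. -/

import Mathlib

universe u

/-- The complete local ring `k⟦x, y, z⟧ / (xy, yz, xz)`, with `x, y, z = X 0, X 1, X 2`. -/
abbrev ThreeLines (k : Type u) [Field k] : Type u :=
  MvPowerSeries (Fin 3) k ⧸
    (Ideal.span {MvPowerSeries.X 0 * MvPowerSeries.X 1, MvPowerSeries.X 1 * MvPowerSeries.X 2,
      MvPowerSeries.X 0 * MvPowerSeries.X 2} : Ideal (MvPowerSeries (Fin 3) k))

instance ThreeLines.instNontrivial (k : Type u) [Field k] : Nontrivial (ThreeLines k) := by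
  refine Ideal.Quotient.nontrivial_iff.mpr fun h => ?_
  have hle : (Ideal.span {MvPowerSeries.X 0 * MvPowerSeries.X 1,
      MvPowerSeries.X 1 * MvPowerSeries.X 2, MvPowerSeries.X 0 * MvPowerSeries.X 2} :
      Ideal (MvPowerSeries (Fin 3) k)) ≤
      RingHom.ker (MvPowerSeries.constantCoeff (σ := Fin 3) (R := k)) := by
    rw [Ideal.span_le]
    rintro p (rfl | rfl | rfl) <;> simp [RingHom.mem_ker]
  have h1 : (1 : MvPowerSeries (Fin 3) k) ∈
      RingHom.ker (MvPowerSeries.constantCoeff (σ := Fin 3) (R := k)) := hle (h ▸ trivial)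
  simp [RingHom.mem_ker] at h1

instance ThreeLines.instIsLocalRing (k : Type u) [Field k] : IsLocalRing (ThreeLines k) :=
  IsLocalRing.of_surjective' (Ideal.Quotient.mk _) Ideal.Quotient.mk_surjective

/-- A minimal free resolution `⋯ → F 2 → F 1 → F 0 → M → 0` of a module `M` over a local ring
`R` with maximal ideal `𝔪`: every `F i` is free of finite rank, the sequence is exact, and the
image of `F (i + 1) → F i` lies in `𝔪 F i`. -/
structure MinimalFreeResolution (R : Type u) [CommRing R] [IsLocalRing R]
    (M : Type u) [AddCommGroup M] [Module R M] where
  F : ℕ → Type u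
  [addCommGroup : ∀ i, AddCommGroup (F i)]
  [module : ∀ i, Module R (F i)]
  [free : ∀ i, Module.Free R (F i)]
  [finite : ∀ i, Module.Finite R (F i)]
  d : ∀ i, F (i + 1) →ₗ[R] F i
  ε : F 0 →ₗ[R] M
  ε_surjective : Function.Surjective ε
  exact_zero : Function.Exact (d 0) ε
  exact_succ : ∀ i, Function.Exact (d (i + 1)) (d i)
  minimal : ∀ i, LinearMap.range (d i) ≤
    IsLocalRing.maximalIdeal R • (⊤ : Submodule R (F i))

attribute [instance] MinimalFreeResolution.addCommGroup MinimalFreeResolution.module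
  MinimalFreeResolution.free MinimalFreeResolution.finite

/-- The number of generators (the rank) of the `i`-th term of a minimal free resolution. -/
noncomputable def MinimalFreeResolution.rank {R : Type u} [CommRing R] [IsLocalRing R]
    {M : Type u} [AddCommGroup M] [Module R M] (P : MinimalFreeResolution R M) (i : ℕ) : ℕ :=
  Module.finrank R (P.F i)

/-- `β` is the Betti sequence of the `R`-module `M`: it records the ranks of the terms of a
minimal free resolution of `M`, regarded as a sequence of rational numbers. -/
def IsBettiSequence (R : Type u) [CommRing R] [IsLocalRing R]
    (M : Type u) [AddCommGroup M] [Module R M] (β : ℕ → ℚ) : Prop :=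
  ∃ P : MinimalFreeResolution R M, ∀ i, β i = P.rank i

/-- The `ℚ≥0`-span of the Betti sequences of all finitely generated `R`-modules. -/
def bettiCone (R : Type u) [CommRing R] [IsLocalRing R] : PointedCone ℚ (ℕ → ℚ) :=
  PointedCone.hull ℚ {β : ℕ → ℚ | ∃ (M : Type u) (_ : AddCommGroup M) (_ : Module R M),
    Module.Finite R M ∧ IsBettiSequence R M β}

/-- The sequence `(1, 0, 0, …)`. -/
def seqFree : ℕ → ℚ
  | 0 => 1
  | _ + 1 => 0

/-- The sequence `(1, 1, 0, 0, …)`. -/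
def seqOneOne : ℕ → ℚ
  | 0 => 1
  | 1 => 1
  | _ + 2 => 0

/-- The sequence `(1, 3, 6, 12, 24, …)`. -/
def seqOneThreeSix : ℕ → ℚ
  | 0 => 1
  | i + 1 => 3 * 2 ^ i

/-! ### Arithmetic of the ring of the three coordinate axes. -/

section ThreeLinesArithmetic

open MvPowerSeries Finsupp

variable {k : Type u} [Field k]

/-! The ring has dimension one and minimal multiplicity: `l = x + y + z` is regular, `𝔪² = l𝔪`, and
`R/lR` has length `3`. Let `Z i = range (d i)` and let `λ` be length modulo `l`. Since `Z i` sits in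
a free module, `l` is regular on it, so `λ` is additive on `0 → Z (i+1) → F (i+1) → Z i → 0` and `3
β (i+1) = λ (Z (i+1)) + λ (Z i)` (`length_quotSMulTop_F`). From the second syzygy on, `𝔪Z = lZ`, so
`λ` counts generators (`length_quotSMulTop_range_succ`) and `β` doubles at each step. For the first
syzygy only `β 1 ≤ λ (Z 0) ≤ 3 β 0` holds; with `3 β 1 = β 2 + λ (Z 0)` this gives the two remaining
inequalities (`exists_mul_rank_one_eq`). Conversely, the inequalities say exactly that the
coordinates of `β` in the three listed sequences are nonnegative, and these sequences are realised
by `R`, `R/lR` and the residue field. -/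

lemma MvPowerSeries.coeff_single_succ_X_mul (a b : Fin 3) (n : ℕ) (q : MvPowerSeries (Fin 3) k) :
    coeff (single a (n + 1)) (X b * q) = if a = b then coeff (single a n) q else 0 := by
  classical
  split_ifs with h
  · subst h
    rw [add_comm n 1, single_add, X, coeff_add_monomial_mul, one_mul]
  · rw [X, coeff_monomial_mul, if_neg]
    intro hle
    have := hle b
    simp [h] at this

lemma MvPowerSeries.exists_eq_X_mul_add_of_coeff_eq_zero {s : Fin 3} {q r : MvPowerSeries (Fin 3) k}
    (h : ∀ m : Fin 3 →₀ ℕ, m s = 0 → coeff m q = coeff m r) :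
    ∃ u, q = X s * u + r := by
  obtain ⟨u, hu⟩ := (X_dvd_iff (s := s) (φ := q - r)).mpr fun m hm ↦ by simp [h m hm]
  exact ⟨u, by rw [← hu]; ring⟩

/-- The terms of a power series which do not involve the variable `s`. -/
noncomputable def MvPowerSeries.dropVar (s : Fin 3) (q : MvPowerSeries (Fin 3) k) :
    MvPowerSeries (Fin 3) k := fun m ↦ if m s = 0 then coeff m q else 0

lemma MvPowerSeries.coeff_dropVar (s : Fin 3) (q : MvPowerSeries (Fin 3) k) (m : Fin 3 →₀ ℕ) :
    coeff m (dropVar s q) = if m s = 0 then coeff m q else 0 := rfl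

lemma MvPowerSeries.exists_eq_X_mul_add_dropVar (s : Fin 3) (q : MvPowerSeries (Fin 3) k) :
    ∃ u, q = X s * u + dropVar s q :=
  exists_eq_X_mul_add_of_coeff_eq_zero fun m hm ↦ by rw [coeff_dropVar, if_pos hm]

lemma Finsupp.eq_single_of_fin_three {a : Fin 3} {m : Fin 3 →₀ ℕ} (h1 : m (a + 1) = 0)
    (h2 : m (a + 2) = 0) : m = single a (m a) := by
  ext b
  have hb : b = a ∨ b = a + 1 ∨ b = a + 2 := by
    clear h1 h2
    revert a b
    decide
  rcases hb with rfl | rfl | rfl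
  · simp
  · rw [h1, single_apply, if_neg (by clear h1 h2; revert a; decide)]
  · rw [h2, single_apply, if_neg (by clear h1 h2; revert a; decide)]

/-- A power series without pure powers of the variable `a` lies in the ideal of the other two. -/
lemma MvPowerSeries.exists_eq_X_mul_add_X_mul {a : Fin 3} {q : MvPowerSeries (Fin 3) k}
    (h : ∀ n, coeff (single a n) q = 0) : ∃ u v, q = X (a + 1) * u + X (a + 2) * v := by
  obtain ⟨u, hu⟩ := exists_eq_X_mul_add_dropVar (a + 1) q
  obtain ⟨v, hv⟩ := exists_eq_X_mul_add_of_coeff_eq_zero (s := a + 2) (q := dropVar (a + 1) q)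
    (r := 0) fun m hm ↦ by
      rw [coeff_dropVar]
      split_ifs with h1
      · rw [eq_single_of_fin_three h1 hm, h, map_zero]
      · simp
  exact ⟨u, v, by rw [add_zero] at hv; rw [← hv]; exact hu⟩

namespace ThreeLines

/-- The defining ideal of the union of the three coordinate axes. -/
noncomputable abbrev ideal (k : Type u) [Field k] : Ideal (MvPowerSeries (Fin 3) k) :=
  Ideal.span {X 0 * X 1, X 1 * X 2, X 0 * X 2}

lemma X_mul_X_mem {a b : Fin 3} (h : a ≠ b) : (X a * X b : MvPowerSeries (Fin 3) k) ∈ ideal k := by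
  have h01 : (X 0 * X 1 : MvPowerSeries (Fin 3) k) ∈ ideal k := Ideal.subset_span (by simp)
  have h12 : (X 1 * X 2 : MvPowerSeries (Fin 3) k) ∈ ideal k := Ideal.subset_span (by simp)
  have h02 : (X 0 * X 2 : MvPowerSeries (Fin 3) k) ∈ ideal k := Ideal.subset_span (by simp)
  fin_cases a <;> fin_cases b <;>
    first | exact absurd rfl h | assumption | (rw [mul_comm]; assumption)

/-- The ideal consists of the series vanishing on all three axes, and restriction to an axis keeps
only the pure powers of its variable. All later computations in the quotient pass through this
criterion. -/
lemma mem_ideal_iff {p : MvPowerSeries (Fin 3) k} :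
    p ∈ ideal k ↔ ∀ a n, coeff (single a n) p = 0 := by
  constructor
  · intro hp a n
    have key : ∀ b c : Fin 3, b ≠ c → ∀ q : MvPowerSeries (Fin 3) k,
        coeff (single a n) (q * (X b * X c)) = 0 := by
      intro b c hbc q
      rw [show q * (X b * X c) = X b * (X c * q) by ring]
      rcases n with _ | n
      · simp
      rw [coeff_single_succ_X_mul]
      split_ifs with h
      · rcases n with _ | n
        · simp
        · rw [coeff_single_succ_X_mul, if_neg (h ▸ hbc)]
      · rfl
    obtain ⟨q₁, z, hz, rfl⟩ := Ideal.mem_span_insert.mp hp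
    obtain ⟨q₂, q₃, rfl⟩ := Ideal.mem_span_pair.mp hz
    rw [map_add, map_add, key 0 1 (by decide), key 1 2 (by decide), key 0 2 (by decide)]
    simp
  · intro h
    obtain ⟨u, v, rfl⟩ := exists_eq_X_mul_add_X_mul (h 0)
    -- In `X 1 * u + X 2 * v` the pure powers of `X 1` come from `u` alone, those of `X 2` from `v`
    -- alone.
    have hu : ∀ n, coeff (single 1 n) u = 0 := fun n ↦ by
      have := h 1 (n + 1)
      rw [map_add, coeff_single_succ_X_mul, coeff_single_succ_X_mul] at this
      simpa using this
    have hv : ∀ n, coeff (single 2 n) v = 0 := fun n ↦ by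
      have := h 2 (n + 1)
      rw [map_add, coeff_single_succ_X_mul, coeff_single_succ_X_mul] at this
      simpa using this
    obtain ⟨u₁, u₂, rfl⟩ := exists_eq_X_mul_add_X_mul hu
    obtain ⟨v₁, v₂, rfl⟩ := exists_eq_X_mul_add_X_mul hv
    simp only [mul_add, ← mul_assoc]
    refine add_mem (add_mem ?_ ?_) (add_mem ?_ ?_) <;>
      exact Ideal.mul_mem_right _ _ (X_mul_X_mem (by decide))

/-- The image of the variable `X a` in the coordinate ring of the three axes. -/
noncomputable abbrev x (a : Fin 3) : ThreeLines k := Ideal.Quotient.mk (ideal k) (X a)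

lemma x_mul_x {a b : Fin 3} (h : a ≠ b) : (x a * x b : ThreeLines k) = 0 := by
  rw [x, x, ← map_mul]
  exact Ideal.Quotient.eq_zero_iff_mem.mpr (X_mul_X_mem h)

lemma mk_eq_zero_iff {p : MvPowerSeries (Fin 3) k} :
    (Ideal.Quotient.mk (ideal k) p : ThreeLines k) = 0 ↔ ∀ a n, coeff (single a n) p = 0 :=
  Ideal.Quotient.eq_zero_iff_mem.trans mem_ideal_iff

lemma coeff_eq_zero_of_sum_x_mul_eq_zero {p : Fin 3 → MvPowerSeries (Fin 3) k}
    (h : ∑ a, x a * (Ideal.Quotient.mk (ideal k) (p a) : ThreeLines k) = 0) (a : Fin 3) (n : ℕ) :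
    coeff (single a n) (p a) = 0 := by
  simp only [x, ← map_mul, ← map_sum] at h
  have := mk_eq_zero_iff.mp h a (n + 1)
  rw [map_sum, Finset.sum_eq_single a] at this
  · rwa [coeff_single_succ_X_mul, if_pos rfl] at this
  · intro b _ hb
    rw [coeff_single_succ_X_mul, if_neg hb.symm]
  · simp

/-- The maximal ideal is the direct sum of the ideals generated by the variables, and the
annihilator of a variable is generated by the other two. -/
lemma exists_of_sum_x_mul_eq_zero {r : Fin 3 → ThreeLines k} (h : ∑ a, x a * r a = 0)
    (a : Fin 3) : ∃ u v, r a = x (a + 1) * u + x (a + 2) * v := by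
  choose p hp using fun a ↦ Ideal.Quotient.mk_surjective (r a)
  obtain rfl : (fun a ↦ Ideal.Quotient.mk (ideal k) (p a)) = r := funext hp
  obtain ⟨u, v, huv⟩ := exists_eq_X_mul_add_X_mul
    fun n ↦ coeff_eq_zero_of_sum_x_mul_eq_zero h a n
  exact ⟨Ideal.Quotient.mk _ u, Ideal.Quotient.mk _ v, by
    simp only [x, ← map_mul, ← map_add]; rw [huv]⟩

/-- The parameter `x + y + z`. -/
noncomputable def parameter (k : Type u) [Field k] : ThreeLines k := ∑ a, x a

lemma isSMulRegular_parameter : IsSMulRegular (ThreeLines k) (parameter k) := by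
  refine isSMulRegular_iff_right_eq_zero_of_smul.mpr fun r hr ↦ ?_
  obtain ⟨p, rfl⟩ := Ideal.Quotient.mk_surjective r
  refine mk_eq_zero_iff.mpr fun a n ↦ ?_
  rw [smul_eq_mul, parameter, Finset.sum_mul] at hr
  exact coeff_eq_zero_of_sum_x_mul_eq_zero (p := fun _ ↦ p) hr a n

lemma parameter_mul_x (a : Fin 3) : parameter k * x a = x a * x a := by
  rw [parameter, Finset.sum_mul, Finset.sum_eq_single a (fun b _ hb ↦ x_mul_x hb) (by simp)]

open IsLocalRing

lemma x_mem_maximalIdeal (a : Fin 3) : (x a : ThreeLines k) ∈ maximalIdeal (ThreeLines k) := by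
  rw [mem_maximalIdeal, mem_nonunits_iff]
  intro hu
  obtain ⟨b, hb⟩ : ∃ b, b ≠ a := exists_ne a
  have h0 : (x b : ThreeLines k) = 0 := by
    simpa using (hu.mul_right_eq_zero (b := x b)).mp (x_mul_x hb.symm)
  have := mk_eq_zero_iff.mp h0 b 1
  simp [coeff_X] at this

lemma exists_eq_sum_x_mul {r : ThreeLines k} (hr : r ∈ maximalIdeal (ThreeLines k)) :
    ∃ s : Fin 3 → ThreeLines k, r = ∑ a, x a * s a := by
  obtain ⟨p, rfl⟩ := Ideal.Quotient.mk_surjective r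
  have hp : coeff 0 p = 0 := by
    by_contra hne
    refine (mem_nonunits_iff.mp ((mem_maximalIdeal _).mp hr)) (IsUnit.map _ ?_)
    exact (isUnit_iff_constantCoeff).mpr (isUnit_iff_ne_zero.mpr hne)
  obtain ⟨u, hu⟩ := exists_eq_X_mul_add_dropVar 0 p
  obtain ⟨v, w, hvw⟩ := exists_eq_X_mul_add_X_mul (a := 0) (q := dropVar 0 p) fun n ↦ by
    rw [coeff_dropVar]
    split_ifs with h
    · obtain rfl : n = 0 := by simpa using h
      simpa using hp
    · rfl
  refine ⟨fun a ↦ Ideal.Quotient.mk _ (![u, v, w] a), ?_⟩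
  rw [hvw] at hu
  rw [hu]
  simp [Fin.sum_univ_three, x, add_assoc]

lemma parameter_mem_maximalIdeal : parameter k ∈ maximalIdeal (ThreeLines k) :=
  sum_mem fun a _ ↦ x_mem_maximalIdeal a

/-- This is `𝔪² = l𝔪`: mixed products `x a * x b` vanish, and `x a * x a = l * x a`. -/
lemma exists_mul_eq_parameter_mul {r s : ThreeLines k} (hr : r ∈ maximalIdeal (ThreeLines k))
    (hs : s ∈ maximalIdeal (ThreeLines k)) :
    ∃ t ∈ maximalIdeal (ThreeLines k), r * s = parameter k * t := by
  obtain ⟨r, rfl⟩ := exists_eq_sum_x_mul hr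
  obtain ⟨s, rfl⟩ := exists_eq_sum_x_mul hs
  refine ⟨∑ a, x a * (r a * s a), sum_mem fun a _ ↦ Ideal.mul_mem_right _ _ (x_mem_maximalIdeal a),
    ?_⟩
  rw [Finset.sum_mul_sum, Finset.mul_sum]
  refine Finset.sum_congr rfl fun a _ ↦ ?_
  rw [Finset.sum_eq_single a]
  · rw [← mul_assoc (parameter k), parameter_mul_x]; ring
  · intro b _ hb
    rw [show x a * r a * (x b * s b) = x a * x b * (r a * s b) by ring, x_mul_x hb.symm, zero_mul]
  · simp

end ThreeLines

end ThreeLinesArithmetic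

/-! ### Length modulo a regular element. -/

section LengthModRegular

open scoped Pointwise

variable {R : Type*} [CommRing R]

lemma Module.length_quotient_range_comp {A B C : Type*} [AddCommGroup A] [AddCommGroup B]
    [AddCommGroup C] [Module R A] [Module R B] [Module R C] (f : A →ₗ[R] B) {g : B →ₗ[R] C}
    (hg : Function.Injective g) :
    Module.length R (C ⧸ LinearMap.range (g ∘ₗ f)) =
      Module.length R (B ⧸ LinearMap.range f) + Module.length R (C ⧸ LinearMap.range g) := by
  have h1 : LinearMap.range f ≤ (LinearMap.range (g ∘ₗ f)).comap g := by
    rintro _ ⟨a, rfl⟩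
    exact ⟨a, rfl⟩
  have h2 : LinearMap.range (g ∘ₗ f) ≤ LinearMap.range g := LinearMap.range_comp_le_range f g
  refine Module.length_eq_add_of_exact (Submodule.mapQ _ _ g h1) (Submodule.factor h2) ?_
    (Submodule.factor_surjective h2) ?_
  · rw [injective_iff_map_eq_zero]
    intro b hb
    obtain ⟨b, rfl⟩ := Submodule.Quotient.mk_surjective _ b
    rw [Submodule.mapQ_apply, Submodule.Quotient.mk_eq_zero] at hb
    obtain ⟨a, ha⟩ := hb
    exact (Submodule.Quotient.mk_eq_zero _).mpr ⟨a, hg ha⟩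
  · intro c
    obtain ⟨c, rfl⟩ := Submodule.Quotient.mk_surjective _ c
    constructor
    · intro hc
      obtain ⟨b, rfl⟩ := (Submodule.Quotient.mk_eq_zero _).mp hc
      exact ⟨Submodule.Quotient.mk b, rfl⟩
    · rintro ⟨b, hb⟩
      obtain ⟨b, rfl⟩ := Submodule.Quotient.mk_surjective _ b
      rw [← hb]
      exact (Submodule.Quotient.mk_eq_zero _).mpr ⟨b, rfl⟩

lemma LinearMap.range_lsmul_eq_smul_top {A : Type*} [AddCommGroup A] [Module R A] (l : R) :
    LinearMap.range (LinearMap.lsmul R A l) = l • (⊤ : Submodule R A) := by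
  ext a
  simp [Submodule.mem_smul_pointwise_iff_exists]

/-- If multiplication by `l` factors through injections `A → B → A` and `B → A → B`, then
`A / l A` and `B / l B` have the same length. -/
lemma Module.length_quotSMulTop_eq_of_comp {A B : Type*} [AddCommGroup A] [AddCommGroup B]
    [Module R A] [Module R B] (l : R) {i : A →ₗ[R] B} {j : B →ₗ[R] A} (hi : Function.Injective i)
    (hj : Function.Injective j) (hji : j ∘ₗ i = LinearMap.lsmul R A l)
    (hij : i ∘ₗ j = LinearMap.lsmul R B l) :
    Module.length R (QuotSMulTop l A) = Module.length R (QuotSMulTop l B) := by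
  have hA := Module.length_quotient_range_comp i hj
  have hB := Module.length_quotient_range_comp j hi
  -- Both lengths are the sum of those of `B / i A` and `A / j B`; no finiteness is needed.
  rw [hji, LinearMap.range_lsmul_eq_smul_top] at hA
  rw [hij, LinearMap.range_lsmul_eq_smul_top, add_comm] at hB
  exact hA.trans hB.symm

variable {F : Type*} [AddCommGroup F] [Module R F]

lemma Module.length_quotSMulTop_eq_of_le {l : R} (hl : IsSMulRegular F l) {N N' : Submodule R F}
    (hle : N ≤ N') (h : ∀ f ∈ N', l • f ∈ N) :
    Module.length R (QuotSMulTop l N) = Module.length R (QuotSMulTop l N') :=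
  Module.length_quotSMulTop_eq_of_comp l (i := Submodule.inclusion hle)
    (j := (LinearMap.lsmul R F l).restrict h) (Submodule.inclusion_injective hle)
    (fun _ _ hab ↦ Subtype.ext (hl (congrArg Subtype.val hab))) rfl rfl

lemma QuotSMulTop.map_injective {A B : Type*} [AddCommGroup A] [AddCommGroup B] [Module R A]
    [Module R B] (l : R) (f : A →ₗ[R] B) (h : ∀ a, (∃ b, l • b = f a) → ∃ a' : A, l • a' = a) :
    Function.Injective (QuotSMulTop.map l f) := by
  rw [injective_iff_map_eq_zero]
  intro a ha
  obtain ⟨a, rfl⟩ := Submodule.Quotient.mk_surjective _ a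
  rw [QuotSMulTop.map_apply_mk, Submodule.Quotient.mk_eq_zero,
    Submodule.mem_smul_pointwise_iff_exists] at ha
  obtain ⟨b, -, hb⟩ := ha
  obtain ⟨a', ha'⟩ := h a ⟨b, hb⟩
  exact (Submodule.Quotient.mk_eq_zero _).mpr
    ((Submodule.mem_smul_pointwise_iff_exists _ _ _).mpr ⟨a', trivial, ha'⟩)

/-- The length modulo a regular element does not increase on passing to a submodule. -/
lemma Module.length_quotSMulTop_submodule_le [IsNoetherian R F] {l : R} (hl : IsSMulRegular F l)
    (N : Submodule R F) :
    Module.length R (QuotSMulTop l N) ≤ Module.length R (QuotSMulTop l F) := by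
  -- Replacing `N` by `(N : l)` keeps the length, because `l (N : l) ⊆ N ⊆ (N : l)`. The ascending
  -- process stops at `N = (N : l)`, where `N / lN` embeds in `F / lF`.
  induction N using IsNoetherian.induction with
  | hgt N ih =>
    have hle : N ≤ N.comap (LinearMap.lsmul R F l) := fun f hf ↦ N.smul_mem l hf
    rcases hle.eq_or_lt with heq | hlt
    · refine Module.length_le_of_injective (QuotSMulTop.map l N.subtype)
        (QuotSMulTop.map_injective l _ fun a ⟨b, hab⟩ ↦ ?_)
      have hb : b ∈ N := by
        rw [heq, Submodule.mem_comap, LinearMap.lsmul_apply, hab]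
        exact a.2
      exact ⟨⟨b, hb⟩, Subtype.ext hab⟩
    · rw [Module.length_quotSMulTop_eq_of_le hl hle fun f hf ↦ hf]
      exact ih _ hlt

lemma IsSMulRegular.of_free [Module.Free R F] {l : R}
    (hl : IsSMulRegular R l) : IsSMulRegular F l := by
  intro f g hfg
  refine (Module.Free.chooseBasis R F).repr.injective (Finsupp.ext fun i ↦ hl ?_)
  have := congrArg (fun f ↦ (Module.Free.chooseBasis R F).repr f i) hfg
  simpa using this

lemma Submodule.smul_top_le_ideal_smul_top {I : Ideal R} {l : R} (hl : l ∈ I) :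
    l • (⊤ : Submodule R F) ≤ I • (⊤ : Submodule R F) := by
  intro f hf
  obtain ⟨g, -, rfl⟩ := (Submodule.mem_smul_pointwise_iff_exists _ _ _).mp hf
  exact Submodule.smul_mem_smul hl trivial

lemma Module.length_quotient_smul_top_of_free [Nontrivial R] [Module.Free R F] [Module.Finite R F]
    (I : Ideal R) :
    Module.length R (F ⧸ I • (⊤ : Submodule R F)) =
      Module.finrank R F * Module.length R (R ⧸ I) := by
  let e : F ≃ₗ[R] (Fin (Module.finrank R F) → R) := (Module.finBasis R F).equivFun
  let e' := (TensorProduct.quotTensorEquivQuotSMul F I).symm ≪≫ₗ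
    (TensorProduct.congr (.refl R (R ⧸ I)) e) ≪≫ₗ
      TensorProduct.piScalarRight R R (R ⧸ I) (Fin (Module.finrank R F))
  rw [e'.length_eq, Module.length_pi]
  simp

lemma Module.length_quotSMulTop_of_free [Nontrivial R] [Module.Free R F] [Module.Finite R F]
    (l : R) :
    Module.length R (QuotSMulTop l F) = Module.finrank R F * Module.length R (QuotSMulTop l R) := by
  have h := Module.length_quotient_smul_top_of_free (F := F) (Ideal.span {l})
  have h' : (Ideal.span {l} : Ideal R) = l • (⊤ : Submodule R R) := by
    rw [← Submodule.ideal_span_singleton_smul, smul_eq_mul, Ideal.mul_top]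
  rw [Submodule.ideal_span_singleton_smul] at h
  rw [h'] at h
  exact h

end LengthModRegular

/-! ### Betti numbers over a ring with `𝔪² = l𝔪`. -/

namespace MinimalFreeResolution

open IsLocalRing
open scoped Pointwise

variable {R : Type u} [CommRing R] [IsLocalRing R] {M : Type u} [AddCommGroup M] [Module R M]
  (P : MinimalFreeResolution R M)

lemma length_quotSMulTop_F {l : R} (hl : IsSMulRegular R l) (i : ℕ) :
    P.rank (i + 1) * Module.length R (QuotSMulTop l R) =
      Module.length R (QuotSMulTop l (LinearMap.range (P.d (i + 1)))) +
        Module.length R (QuotSMulTop l (LinearMap.range (P.d i))) := by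
  rw [rank, ← Module.length_quotSMulTop_of_free]
  have hex : Function.Exact (LinearMap.range (P.d (i + 1))).subtype (P.d i).rangeRestrict := by
    rw [LinearMap.exact_iff, LinearMap.ker_rangeRestrict, Submodule.range_subtype]
    exact (P.exact_succ i).linearMap_ker_eq
  refine Module.length_eq_add_of_exact _ _ (QuotSMulTop.map_injective l _ ?_)
    (QuotSMulTop.map_surjective l (P.d i).surjective_rangeRestrict)
    (QuotSMulTop.map_exact l hex (P.d i).surjective_rangeRestrict)
  rintro a ⟨b, hab⟩
  have hb : P.d i b = 0 := by
    refine (hl.of_free).right_eq_zero_of_smul ?_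
    rw [← map_smul, hab]
    exact (P.exact_succ i _).mpr a.2
  exact ⟨⟨b, (P.exact_succ i _).mp hb⟩, Subtype.ext hab⟩

/-- By minimality the kernel of `F (i+1) → Z i` lies in `𝔪 F (i+1)`, so the map becomes an
isomorphism modulo `𝔪`. -/
lemma length_quotient_maximalIdeal_smul (i : ℕ) :
    Module.length R (LinearMap.range (P.d i) ⧸
      (maximalIdeal R • ⊤ : Submodule R (LinearMap.range (P.d i)))) = P.rank (i + 1) := by
  have h1 : Module.length R (R ⧸ maximalIdeal R) = 1 := by
    have : IsSimpleModule R (R ⧸ maximalIdeal R) :=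
      isSimpleModule_iff_isCoatom.mpr (maximalIdeal.isMaximal R).out
    exact Module.length_eq_one R _
  have hF := Module.length_quotient_smul_top_of_free (F := P.F (i + 1)) (maximalIdeal R)
  rw [h1, mul_one] at hF
  rw [rank, ← hF]
  set π := (maximalIdeal R • ⊤ : Submodule R (LinearMap.range (P.d i))).mkQ ∘ₗ
    (P.d i).rangeRestrict with hπ
  have hker : LinearMap.ker π = maximalIdeal R • (⊤ : Submodule R (P.F (i + 1))) := by
    have hmap : (maximalIdeal R • ⊤ : Submodule R (LinearMap.range (P.d i))) =
        (maximalIdeal R • (⊤ : Submodule R (P.F (i + 1)))).map (P.d i).rangeRestrict := by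
      rw [Submodule.map_smul'', Submodule.map_top, LinearMap.range_rangeRestrict]
    rw [hπ, LinearMap.ker_comp, Submodule.ker_mkQ, hmap, Submodule.comap_map_eq,
      LinearMap.ker_rangeRestrict, (P.exact_succ i).linearMap_ker_eq]
    exact sup_eq_left.mpr (P.minimal (i + 1))
  have hsurj : Function.Surjective π :=
    (Submodule.mkQ_surjective _).comp (P.d i).surjective_rangeRestrict
  exact ((Submodule.quotEquivOfEq _ _ hker.symm).trans
    (π.quotKerEquivOfSurjective hsurj)).length_eq.symm

lemma rank_succ_le_length_quotSMulTop {l : R} (hl : l ∈ maximalIdeal R) (i : ℕ) :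
    P.rank (i + 1) ≤ Module.length R (QuotSMulTop l (LinearMap.range (P.d i))) := by
  rw [← P.length_quotient_maximalIdeal_smul]
  have hle : l • (⊤ : Submodule R (LinearMap.range (P.d i))) ≤ maximalIdeal R • ⊤ :=
    Submodule.smul_top_le_ideal_smul_top hl
  exact Module.length_le_of_surjective (Submodule.factor hle) (Submodule.factor_surjective hle)

section MinimalMultiplicity

variable {l : R} (hlm : l ∈ maximalIdeal R)
  (hmm : ∀ r ∈ maximalIdeal R, ∀ s ∈ maximalIdeal R, ∃ t ∈ maximalIdeal R, r * s = l * t)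

include hlm hmm

/-- The hypothesis yields `𝔪Z = lZ` for `Z = range (d i)`: as `Z ⊆ 𝔪F`, an element of `𝔪Z` lies in
`𝔪²F = l𝔪F`, and its quotient by `l` is again in `Z`. -/
lemma length_quotSMulTop_range_eq_rank {i : ℕ}
    (h : ∀ f ∈ maximalIdeal R • (⊤ : Submodule R (P.F i)), l • f ∈ LinearMap.range (P.d i) →
      f ∈ LinearMap.range (P.d i)) :
    Module.length R (QuotSMulTop l (LinearMap.range (P.d i))) = P.rank (i + 1) := by
  rw [← P.length_quotient_maximalIdeal_smul]
  have heq : l • (⊤ : Submodule R (LinearMap.range (P.d i))) = maximalIdeal R • ⊤ := by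
    refine le_antisymm ?_ ?_
    · exact Submodule.smul_top_le_ideal_smul_top hlm
    · refine Submodule.smul_le.mpr fun r hr n _ ↦ ?_
      have key : ∀ f ∈ maximalIdeal R • (⊤ : Submodule R (P.F i)),
          ∃ f' ∈ maximalIdeal R • (⊤ : Submodule R (P.F i)), r • f = l • f' := by
        intro f hf
        induction hf using Submodule.smul_induction_on' with
        | smul s hs f _ =>
          obtain ⟨t, ht, hrs⟩ := hmm r hr s hs
          exact ⟨t • f, Submodule.smul_mem_smul ht trivial, by rw [smul_smul, hrs, mul_smul]⟩
        | add f _ g _ hf hg =>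
          obtain ⟨f', hf', hf⟩ := hf
          obtain ⟨g', hg', hg⟩ := hg
          exact ⟨f' + g', add_mem hf' hg', by rw [smul_add, smul_add, hf, hg]⟩
      obtain ⟨f, hf, hn⟩ := key n (P.minimal i n.2)
      refine (Submodule.mem_smul_pointwise_iff_exists _ _ _).mpr
        ⟨⟨f, h f hf (hn ▸ (r • n).2)⟩, trivial, Subtype.ext hn.symm⟩
  exact (Submodule.quotEquivOfEq _ _ heq).length_eq

lemma length_quotSMulTop_range_succ (hl : IsSMulRegular R l) (i : ℕ) :
    Module.length R (QuotSMulTop l (LinearMap.range (P.d (i + 1)))) = P.rank (i + 2) := by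
  refine P.length_quotSMulTop_range_eq_rank hlm hmm fun f _ hf ↦ (P.exact_succ i _).mp ?_
  refine (hl.of_free).right_eq_zero_of_smul ?_
  rw [← map_smul]
  exact (P.exact_succ i _).mpr hf

/-- The multiplicity of the ring, computed from a resolution of a module killed by the maximal
ideal. -/
lemma rank_zero_mul_length (hl : IsSMulRegular R l)
    (hM : ∀ r ∈ maximalIdeal R, ∀ m : M, r • m = 0) :
    P.rank 0 * Module.length R (QuotSMulTop l R) = P.rank 1 := by
  -- As `𝔪M = 0`, the first syzygy contains `𝔪 F 0`, hence `l F 0`; it therefore has the same length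
  -- modulo `l` as `F 0`.
  have hrange : ∀ f ∈ maximalIdeal R • (⊤ : Submodule R (P.F 0)), f ∈ LinearMap.range (P.d 0) := by
    intro f hf
    refine (P.exact_zero f).mp ?_
    induction hf using Submodule.smul_induction_on' with
    | smul s hs f _ => rw [map_smul, hM s hs]
    | add f _ g _ hf hg => rw [map_add, hf, hg, add_zero]
  rw [← P.length_quotSMulTop_range_eq_rank hlm hmm fun f hf _ ↦ hrange f hf, rank,
    ← Module.length_quotSMulTop_of_free,
    Module.length_quotSMulTop_eq_of_le (hl.of_free) le_top
      fun f _ ↦ hrange _ (Submodule.smul_mem_smul hlm trivial)]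
  exact (QuotSMulTop.congr l Submodule.topEquiv).symm.length_eq

variable {e : ℕ} (he : Module.length R (QuotSMulTop l R) = e)

include he

lemma mul_rank_eq (hl : IsSMulRegular R l) (i : ℕ) :
    P.rank (i + 2) * e = P.rank (i + 3) + P.rank (i + 2) := by
  have h := P.length_quotSMulTop_F hl (i + 1)
  rw [P.length_quotSMulTop_range_succ hlm hmm hl, P.length_quotSMulTop_range_succ hlm hmm hl, he]
    at h
  exact_mod_cast h

/-- Here `n` is the length of `Z 0 / l Z 0`, finite because it is at most that of `F 0 / l F 0`. -/
lemma exists_mul_rank_one_eq [IsNoetherianRing R] (hl : IsSMulRegular R l) :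
    ∃ n : ℕ, P.rank 1 * e = P.rank 2 + n ∧ P.rank 1 ≤ n ∧ n ≤ P.rank 0 * e := by
  have h := P.length_quotSMulTop_F hl 0
  have hle := Module.length_quotSMulTop_submodule_le (hl.of_free)
    (LinearMap.range (P.d 0))
  have hge := P.rank_succ_le_length_quotSMulTop hlm 0
  rw [Module.length_quotSMulTop_of_free (F := P.F 0), he] at hle
  rw [P.length_quotSMulTop_range_succ hlm hmm hl, he] at h
  obtain ⟨n, hn⟩ := ENat.ne_top_iff_exists.mp (ne_top_of_le_ne_top (by
    exact_mod_cast ENat.natCast_ne_top (Module.finrank R (P.F 0) * e)) hle)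
  rw [← hn] at h hle hge
  exact ⟨n, by exact_mod_cast h, by exact_mod_cast hge, by exact_mod_cast hle⟩

end MinimalMultiplicity

end MinimalFreeResolution

/-! ### The resolution of the residue field. -/

namespace ThreeLines

open IsLocalRing

variable (k : Type u) [Field k]

/-- The basis of the `n`-th term of the minimal resolution of the residue field: words of length
`n` in the three variables without repeated neighbours, given by the first letter and the steps
between consecutive letters. -/
inductive ReducedWord : ℕ → Type
  | nil : ReducedWord 0
  | word {n : ℕ} (a : Fin 3) (s : Fin n → Bool) : ReducedWord (n + 1)

/-- The empty word is the only one of length zero. -/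
def ReducedWord.zeroEquiv : ReducedWord 0 ≃ Unit where
  toFun _ := ()
  invFun _ := .nil
  left_inv | .nil => rfl
  right_inv _ := rfl

/-- A nonempty word is determined by its first letter and its steps. -/
def ReducedWord.succEquiv (n : ℕ) : ReducedWord (n + 1) ≃ Fin 3 × (Fin n → Bool) where
  toFun | .word a s => (a, s)
  invFun p := .word p.1 p.2
  left_inv | .word _ _ => rfl
  right_inv _ := rfl

instance ReducedWord.instFintype : ∀ n, Fintype (ReducedWord n)
  | 0 => Fintype.ofEquiv _ zeroEquiv.symm
  | n + 1 => Fintype.ofEquiv _ (succEquiv n).symm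

open ReducedWord

/-- The differential sends the basis vector of a word `a w` to `x a` times that of `w`. -/
noncomputable def wordDifferential (n : ℕ) :
    (ReducedWord (n + 1) → ThreeLines k) →ₗ[ThreeLines k] (ReducedWord n → ThreeLines k) where
  toFun r
    | nil => ∑ a, x a * r (word a Fin.elim0)
    | word a s => x (a + 1) * r (word (a + 1) (Fin.cons true s : Fin (_ + 1) → Bool)) +
        x (a + 2) * r (word (a + 2) (Fin.cons false s : Fin (_ + 1) → Bool))
  map_add' r r' := by
    funext w
    cases w
    · simp only [Pi.add_apply, mul_add, Finset.sum_add_distrib]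
    · simp only [Pi.add_apply]
      ring
  map_smul' c r := by
    funext w
    cases w
    · simp only [Pi.smul_apply, smul_eq_mul, Finset.mul_sum, RingHom.id_apply]
      exact Finset.sum_congr rfl fun a _ ↦ mul_left_comm _ _ _
    · simp only [Pi.smul_apply, smul_eq_mul, RingHom.id_apply]
      ring

variable {k}

lemma wordDifferential_nil (r : ReducedWord 1 → ThreeLines k) :
    wordDifferential k 0 r nil = ∑ a, x a * r (word a Fin.elim0) := rfl

lemma wordDifferential_word {n : ℕ} (r : ReducedWord (n + 2) → ThreeLines k) (a : Fin 3)
    (s : Fin n → Bool) :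
    wordDifferential k (n + 1) r (word a s) =
      x (a + 1) * r (word (a + 1) (Fin.cons true s : Fin (n + 1) → Bool)) +
        x (a + 2) * r (word (a + 2) (Fin.cons false s : Fin (n + 1) → Bool)) := rfl

lemma wordDifferential_comp (n : ℕ) (r : ReducedWord (n + 2) → ThreeLines k) :
    wordDifferential k n (wordDifferential k (n + 1) r) = 0 := by
  have h1 : ∀ a : Fin 3, a ≠ a + 1 := by decide
  have h2 : ∀ a : Fin 3, a ≠ a + 2 := by decide
  have hx : ∀ (a : Fin 3) (s : Fin n → Bool), x a * wordDifferential k (n + 1) r (word a s) = 0 := by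
    intro a s
    rw [wordDifferential_word, mul_add, ← mul_assoc, ← mul_assoc, x_mul_x (h1 a),
      x_mul_x (h2 a), zero_mul, zero_mul, add_zero]
  funext w
  cases w with
  | nil => exact (wordDifferential_nil _).trans (Finset.sum_eq_zero fun a _ ↦ hx a Fin.elim0)
  | word a s =>
    rw [wordDifferential_word, hx, hx, add_zero]
    rfl

/-- The coefficient at a word starting with `a` is hit exactly through its extensions by the two
letters other than `a`, and each longer word has a single tail, so the coefficients can be lifted
independently. -/
lemma exists_wordDifferential_eq {n : ℕ} {r : ReducedWord (n + 1) → ThreeLines k}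
    (h : ∀ (a : Fin 3) (s : Fin n → Bool), ∃ u v, r (word a s) = x (a + 1) * u + x (a + 2) * v) :
    ∃ r', wordDifferential k (n + 1) r' = r := by
  choose u v huv using h
  -- The step `true` leads from `a` to the next letter `a - 1 = a + 2`, the step `false` to `a + 1`.
  refine ⟨fun | word a s => if s 0 then u (a + 2) (Fin.tail s) else v (a + 1) (Fin.tail s), ?_⟩
  funext w
  obtain _ | ⟨a, s⟩ := w
  have h3 : a + 1 + 2 = a := by revert a; decide
  have h3' : a + 2 + 1 = a := by revert a; decide
  rw [wordDifferential_word, huv]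
  simp [h3, h3']

/-- The missing term for `x a` is filled in with coefficient zero, reducing to the relation among
all three variables. -/
lemma exists_of_x_mul_add_x_mul_eq_zero {a : Fin 3} {r s : ThreeLines k}
    (h : x (a + 1) * r + x (a + 2) * s = 0) :
    (∃ u v, r = x (a + 1 + 1) * u + x (a + 1 + 2) * v) ∧
      ∃ u v, s = x (a + 2 + 1) * u + x (a + 2 + 2) * v := by
  have h12 : a + 2 ≠ a + 1 := by clear h; revert a; decide
  have hsum : ∑ b, x b * (if b = a + 1 then r else if b = a + 2 then s else 0) = 0 := by
    refine Eq.trans ?_ h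
    rw [← Finset.sum_subset (Finset.subset_univ {a + 1, a + 2}), Finset.sum_pair h12.symm]
    · simp [h12]
    · intro b _ hb
      simp only [Finset.mem_insert, Finset.mem_singleton, not_or] at hb
      simp [hb.1, hb.2]
  have e1 := exists_of_sum_x_mul_eq_zero hsum (a + 1)
  have e2 := exists_of_sum_x_mul_eq_zero hsum (a + 2)
  rw [if_pos rfl] at e1
  rw [if_neg h12, if_pos rfl] at e2
  exact ⟨e1, e2⟩

lemma exact_wordDifferential (n : ℕ) :
    Function.Exact (wordDifferential k (n + 1)) (wordDifferential k n) := by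
  refine fun r ↦ ⟨fun hr ↦ exists_wordDifferential_eq fun a s ↦ ?_, ?_⟩
  · rcases n with _ | n
    · rw [Subsingleton.elim s Fin.elim0]
      exact exists_of_sum_x_mul_eq_zero (r := fun a ↦ r (word a Fin.elim0)) (congrFun hr nil) a
    · obtain ⟨b, t, rfl⟩ : ∃ (b : Bool) (t : Fin n → Bool), s = (Fin.cons b t : Fin (n + 1) → Bool) :=
        ⟨s 0, Fin.tail s, (Fin.cons_self_tail s).symm⟩
      cases b
      · obtain ⟨c, rfl⟩ : ∃ c, a = c + 2 := ⟨a + 1, by clear * -; revert a; decide⟩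
        exact (exists_of_x_mul_add_x_mul_eq_zero (congrFun hr (word c t))).2
      · obtain ⟨c, rfl⟩ : ∃ c, a = c + 1 := ⟨a + 2, by clear * -; revert a; decide⟩
        exact (exists_of_x_mul_add_x_mul_eq_zero (congrFun hr (word c t))).1
  · rintro ⟨r, rfl⟩
    exact wordDifferential_comp n r

lemma mem_maximalIdeal_smul_top {ι : Type*} [Finite ι] {f : ι → ThreeLines k}
    (h : ∀ i, f i ∈ maximalIdeal (ThreeLines k)) :
    f ∈ maximalIdeal (ThreeLines k) • (⊤ : Submodule (ThreeLines k) (ι → ThreeLines k)) := by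
  classical
  have := Fintype.ofFinite ι
  rw [pi_eq_sum_univ f]
  exact sum_mem fun i _ ↦ Submodule.smul_mem_smul (h i) trivial

lemma wordDifferential_nil_mem (r : ReducedWord 1 → ThreeLines k) :
    wordDifferential k 0 r nil ∈ maximalIdeal (ThreeLines k) := by
  rw [wordDifferential_nil]
  exact sum_mem fun a _ ↦ Ideal.mul_mem_right _ _ (x_mem_maximalIdeal a)

lemma wordDifferential_mem (n : ℕ) (r : ReducedWord (n + 1) → ThreeLines k) :
    wordDifferential k n r ∈ maximalIdeal (ThreeLines k) •
      (⊤ : Submodule (ThreeLines k) (ReducedWord n → ThreeLines k)) := by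
  refine mem_maximalIdeal_smul_top fun w ↦ ?_
  cases w with
  | nil => exact wordDifferential_nil_mem r
  | word a s =>
    exact add_mem (Ideal.mul_mem_right _ _ (x_mem_maximalIdeal _))
      (Ideal.mul_mem_right _ _ (x_mem_maximalIdeal _))

variable (k)

/-- The minimal free resolution of the residue field. -/
noncomputable def residueFieldResolution :
    MinimalFreeResolution (ThreeLines k) (ThreeLines k ⧸ maximalIdeal (ThreeLines k)) where
  F n := ReducedWord n → ThreeLines k
  d := wordDifferential k
  ε := (maximalIdeal (ThreeLines k)).mkQ ∘ₗ
    LinearMap.proj (R := ThreeLines k) (φ := fun _ ↦ ThreeLines k) nil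
  ε_surjective := (Submodule.mkQ_surjective _).comp fun r ↦ ⟨fun _ ↦ r, rfl⟩
  exact_zero := by
    refine fun r ↦ (Submodule.Quotient.mk_eq_zero (maximalIdeal (ThreeLines k))).trans ⟨?_, ?_⟩
    · intro h
      obtain ⟨s, hs⟩ := exists_eq_sum_x_mul h
      exact ⟨fun | word a _ => s a, funext fun | nil => hs.symm⟩
    · rintro ⟨s, rfl⟩
      exact wordDifferential_nil_mem s
  exact_succ := exact_wordDifferential
  minimal n := by
    rintro _ ⟨r, rfl⟩
    exact wordDifferential_mem n r

lemma residueFieldResolution_rank_zero : (residueFieldResolution k).rank 0 = 1 :=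
  (Module.finrank_pi (ThreeLines k)).trans ((Fintype.card_congr zeroEquiv).trans Fintype.card_unit)

lemma residueFieldResolution_rank_succ (n : ℕ) :
    (residueFieldResolution k).rank (n + 1) = 3 * 2 ^ n :=
  (Module.finrank_pi (ThreeLines k)).trans
    ((Fintype.card_congr (succEquiv n)).trans (by simp))

/-- The multiplicity is read off as `β 1 / β 0 = 3` for the residue field. -/
lemma length_quotSMulTop_parameter :
    Module.length (ThreeLines k) (QuotSMulTop (parameter k) (ThreeLines k)) = (3 : ℕ) := by
  have h := (residueFieldResolution k).rank_zero_mul_length parameter_mem_maximalIdeal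
    (fun r hr s hs ↦ exists_mul_eq_parameter_mul hr hs) isSMulRegular_parameter
    (fun r hr m ↦ by
      obtain ⟨m, rfl⟩ := Submodule.Quotient.mk_surjective _ m
      exact (Submodule.Quotient.mk_eq_zero _).mpr (Ideal.mul_mem_right _ _ hr))
  rwa [residueFieldResolution_rank_zero, residueFieldResolution_rank_succ, Nat.cast_one, one_mul,
    pow_zero, mul_one] at h

/-! ### Realising the three extremal sequences. -/

/-- The minimal free resolution of the free module of rank one. -/
noncomputable def freeResolution : MinimalFreeResolution (ThreeLines k) (ThreeLines k) where
  -- Since `0 ^ 0 = 1`, the rank is one in degree zero and zero afterwards.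
  F n := Fin (0 ^ n) → ThreeLines k
  d _ := 0
  ε := LinearMap.proj (R := ThreeLines k) (φ := fun _ ↦ ThreeLines k) (0 : Fin 1)
  ε_surjective r := ⟨fun _ ↦ r, rfl⟩
  exact_zero r := by
    constructor
    · intro h
      refine ⟨0, funext fun i : Fin 1 ↦ ?_⟩
      rw [Subsingleton.elim i 0]
      exact h.symm
    · rintro ⟨_, rfl⟩
      rfl
  exact_succ i r := by
    refine ⟨fun _ ↦ ⟨0, funext fun j ↦ ?_⟩, fun _ ↦ rfl⟩
    exact (Fin.cast (by simp) j : Fin 0).elim0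
  minimal i := by simp

/-- The ranks in the resolution of a hypersurface section. -/
def sectionRank : ℕ → ℕ
  | 0 => 1
  | 1 => 1
  | _ + 2 => 0

/-- The minimal free resolution of the quotient by the parameter. -/
noncomputable def sectionResolution :
    MinimalFreeResolution (ThreeLines k) (ThreeLines k ⧸ Ideal.span {parameter k}) where
  F n := Fin (sectionRank n) → ThreeLines k
  d
    | 0 => LinearMap.lsmul (ThreeLines k) (Fin 1 → ThreeLines k) (parameter k)
    | _ + 1 => 0
  ε := (Ideal.span {parameter k}).mkQ ∘ₗ
    LinearMap.proj (R := ThreeLines k) (φ := fun _ ↦ ThreeLines k) (0 : Fin 1)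
  ε_surjective := (Submodule.mkQ_surjective _).comp fun r ↦ ⟨fun _ ↦ r, rfl⟩
  exact_zero r := by
    refine (Submodule.Quotient.mk_eq_zero (Ideal.span {parameter k})).trans
      (Ideal.mem_span_singleton.trans ⟨?_, ?_⟩)
    · rintro ⟨s, hs⟩
      refine ⟨fun _ ↦ s, funext fun i : Fin 1 ↦ ?_⟩
      rw [Subsingleton.elim i 0]
      exact hs.symm
    · rintro ⟨s, rfl⟩
      exact ⟨s (0 : Fin 1), rfl⟩
  exact_succ
    | 0 => fun r ↦ by
      constructor
      · intro h
        refine ⟨0, funext fun i : Fin 1 ↦ ?_⟩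
        exact (isSMulRegular_parameter.right_eq_zero_of_smul (congrFun h i)).symm
      · rintro ⟨s, rfl⟩
        exact smul_zero _
    | n + 1 => fun r ↦ ⟨fun _ ↦ ⟨0, funext fun j : Fin 0 ↦ j.elim0⟩, fun _ ↦ rfl⟩
  minimal
    | 0 => by
      rintro _ ⟨r, rfl⟩
      exact Submodule.smul_mem_smul parameter_mem_maximalIdeal trivial
    | n + 1 => by
      rw [LinearMap.range_zero]
      exact bot_le

lemma seqFree_mem_bettiCone : seqFree ∈ bettiCone (ThreeLines k) := by
  refine Submodule.subset_span ⟨_, _, _, inferInstance, freeResolution k, fun i ↦ ?_⟩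
  have h : (freeResolution k).rank i = 0 ^ i := Module.finrank_fin_fun (ThreeLines k)
  rw [h]
  rcases i with _ | i <;> simp [seqFree]

lemma seqOneOne_mem_bettiCone : seqOneOne ∈ bettiCone (ThreeLines k) := by
  refine Submodule.subset_span ⟨_, _, _, inferInstance, sectionResolution k, fun i ↦ ?_⟩
  have h : (sectionResolution k).rank i = sectionRank i := Module.finrank_fin_fun (ThreeLines k)
  rw [h]
  rcases i with _ | _ | i <;> simp [seqOneOne, sectionRank]

lemma seqOneThreeSix_mem_bettiCone : seqOneThreeSix ∈ bettiCone (ThreeLines k) := by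
  refine Submodule.subset_span ⟨_, _, _, inferInstance, residueFieldResolution k, fun i ↦ ?_⟩
  rcases i with _ | i
  · rw [residueFieldResolution_rank_zero]
    simp [seqOneThreeSix]
  · rw [residueFieldResolution_rank_succ]
    simp [seqOneThreeSix]

/-! ### Comparison of the three cones. -/

/-- The cone cut out by the linear inequalities and the recurrence. -/
def inequalityCone : PointedCone ℚ (ℕ → ℚ) where
  carrier := {β | 0 ≤ β 2 ∧ 3 * β 1 ≤ 3 * β 0 + β 2 ∧ β 2 ≤ 2 * β 1 ∧
    ∀ i, 2 < i → β i = 2 * β (i - 1)}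
  add_mem' := by
    rintro β γ ⟨h1, h2, h3, h4⟩ ⟨h1', h2', h3', h4'⟩
    simp only [Set.mem_ofPred_eq, Pi.add_apply]
    exact ⟨by linarith, by linarith, by linarith, fun i hi ↦ by rw [h4 i hi, h4' i hi]; ring⟩
  zero_mem' := by simp
  smul_mem' := by
    rintro ⟨c, hc⟩ β ⟨h1, h2, h3, h4⟩
    simp only [Set.mem_ofPred_eq, Nonneg.mk_smul, Pi.smul_apply, smul_eq_mul]
    refine ⟨by positivity, ?_, ?_, fun i hi ↦ by rw [h4 i hi]; ring⟩
    · linarith [mul_le_mul_of_nonneg_left h2 hc]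
    · linarith [mul_le_mul_of_nonneg_left h3 hc]

lemma bettiCone_le_inequalityCone : bettiCone (ThreeLines k) ≤ inequalityCone := by
  refine Submodule.span_le.mpr ?_
  rintro β ⟨M, _, _, -, P, hP⟩
  have hmm : ∀ r ∈ maximalIdeal (ThreeLines k), ∀ s ∈ maximalIdeal (ThreeLines k),
      ∃ t ∈ maximalIdeal (ThreeLines k), r * s = parameter k * t :=
    fun r hr s hs ↦ exists_mul_eq_parameter_mul hr hs
  obtain ⟨n, h1, h2, h3⟩ := P.exists_mul_rank_one_eq parameter_mem_maximalIdeal hmm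
    (length_quotSMulTop_parameter k) isSMulRegular_parameter
  have h := P.mul_rank_eq parameter_mem_maximalIdeal hmm
    (length_quotSMulTop_parameter k) isSMulRegular_parameter
  refine ⟨?_, ?_, ?_, ?_⟩
  · rw [hP]
    positivity
  · rw [hP, hP, hP]
    norm_cast
    lia
  · rw [hP, hP]
    norm_cast
    lia
  · intro i hi
    obtain ⟨j, rfl⟩ : ∃ j, i = j + 3 := ⟨i - 3, by lia⟩
    have hj := h j
    rw [hP, hP, show j + 3 - 1 = j + 2 by lia]
    norm_cast
    lia

lemma inequalityCone_le_hull :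
    inequalityCone ≤ PointedCone.hull ℚ {seqFree, seqOneOne, seqOneThreeSix} := by
  rintro β ⟨h1, h2, h3, h4⟩
  have hβ : ∀ i, β (i + 2) = β 2 * 2 ^ i := by
    intro i
    induction i with
    | zero => simp
    | succ i ih =>
      rw [h4 (i + 1 + 2) (by lia), show i + 1 + 2 - 1 = i + 2 by lia, ih]
      ring
  -- The coefficients solve a triangular system, beginning with the entry `6` of `seqOneThreeSix` in
  -- degree two; each one is nonnegative by one of the three inequalities.
  have hsum : β = (⟨β 0 - β 1 + β 2 / 3, by linarith⟩ : {c : ℚ // 0 ≤ c}) • seqFree +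
      (⟨β 1 - β 2 / 2, by linarith⟩ : {c : ℚ // 0 ≤ c}) • seqOneOne +
      (⟨β 2 / 6, by linarith⟩ : {c : ℚ // 0 ≤ c}) • seqOneThreeSix := by
    funext i
    rcases i with _ | _ | i
    · simp [seqFree, seqOneOne, seqOneThreeSix]; ring
    · simp [seqFree, seqOneOne, seqOneThreeSix]; ring
    · simp only [hβ i, Pi.add_apply, Pi.smul_apply, seqFree, seqOneOne, seqOneThreeSix, Nonneg.mk_smul,
        smul_eq_mul]
      ring
  rw [hsum]
  refine add_mem (add_mem ?_ ?_) ?_ <;>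
    exact Submodule.smul_mem _ _ (Submodule.subset_span (by simp))

lemma hull_le_bettiCone :
    PointedCone.hull ℚ {seqFree, seqOneOne, seqOneThreeSix} ≤ bettiCone (ThreeLines k) := by
  refine Submodule.span_le.mpr ?_
  rintro _ (rfl | rfl | rfl)
  · exact seqFree_mem_bettiCone k
  · exact seqOneOne_mem_bettiCone k
  · exact seqOneThreeSix_mem_bettiCone k

end ThreeLines

theorem mainTheorem3 (k : Type u) [Field k] :
    (bettiCone (ThreeLines k) : Set (ℕ → ℚ)) =
        (PointedCone.hull ℚ {seqFree, seqOneOne, seqOneThreeSix} : Set (ℕ → ℚ)) ∧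
      (bettiCone (ThreeLines k) : Set (ℕ → ℚ)) =
        {β : ℕ → ℚ | 0 ≤ β 2 ∧ 3 * β 1 ≤ 3 * β 0 + β 2 ∧ β 2 ≤ 2 * β 1 ∧
          ∀ i, 2 < i → β i = 2 * β (i - 1)} := by
  have h1 := ThreeLines.bettiCone_le_inequalityCone k
  have h2 := ThreeLines.inequalityCone_le_hull
  have h3 := ThreeLines.hull_le_bettiCone k
  exact ⟨congrArg _ (le_antisymm (h1.trans h2) h3), congrArg _ (le_antisymm h1 (h2.trans h3))⟩
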